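/- Let $0<\alpha<1$. For each integer $n\ge 1$ let $\mu=\mu_n$ be the measure on $\mathbb{R}^n$ (with the Euclidean norm $|\cdot|$) given by $d\mu(x)=\bigl|1-|x|\bigr|^{-\alpha}\,dx$. Let $B(x,r)$ denote the open ball with centre $x$ and radius $r$, and let $$M_\mu f(x)=\sup_{r>0}\frac{1}{\mu(B(x,r))}\int_{B(x,r)}|f|\,d\mu$$ be the centred maximal operator of $\mu$. Then the following hold. (i) For every $n\ge1$ the measure $\mu$ is doubling on $\mathbb{R}^n$: there is $K<\infty$ (which may depend on $n$ and $\alpha$) such that $\mu(B(x,2R))\le K\,\mu(B(x,R))$ for all $x\in\mathbb{R}^n$ and $R>0$. (ii) There is a constant $c>0$ depending only on $\alpha$ such that for every $n\ge1$ the following is true: there is a smallest finite constant $C_{1,n}\ge 0$ satisfying $$\mu(\{x\in\mathbb{R}^n: M_\mu f(x)>\lambda\})\le\frac{C_{1,n}}{\lambda}\,\|f\|_{L^1(\mathbb{R}^n,\mu)}\qquad\text{for all } f\in L^1(\mathbb{R}^n,\mu)\text{ and }\lambda>0,$$ and it satisfies $C_{1,n}\ge c\,n^{\alpha}$. (iii)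 Consequently there is no dimension-free weak $L^1$ bound: no finite constant $C$ satisfies the inequality in (ii), in place of $C_{1,n}$, for all $n\ge1$. -/

import Mathlib

open MeasureTheory
open scoped ENNReal NNReal

noncomputable section

/-- The radial weight `w(x) = |1 - |x||^{-α}` on `ℝⁿ` with its Euclidean norm. On the unit sphere,
a null set when `1 ≤ n`, where `w` is infinite, the convention `0 ^ (-α) = 0` applies. -/
def radialWeight (α : ℝ) (n : ℕ) (x : EuclideanSpace ℝ (Fin n)) : ℝ :=
  |1 - ‖x‖| ^ (-α)

/-- The measure `dμ = w(x) dx` on `ℝⁿ`. -/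
def radialMeasure (α : ℝ) (n : ℕ) : Measure (EuclideanSpace ℝ (Fin n)) :=
  volume.withDensity fun x => ENNReal.ofReal (radialWeight α n x)

/-- `μ` is doubling: `μ(B(x,2R)) ≤ K μ(B(x,R))` for all centres `x` and all radii `R > 0`, with a
finite constant `K`. -/
def IsDoubling {X : Type*} [PseudoMetricSpace X] [MeasurableSpace X] (μ : Measure X) : Prop :=
  ∃ K : ℝ≥0, ∀ (x : X) (R : ℝ), 0 < R →
    μ (Metric.ball x (2 * R)) ≤ (K : ℝ≥0∞) * μ (Metric.ball x R)

/-- The centred Hardy-Littlewood maximal function of `f` with respect to `μ`, over open balls. -/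
def maximalFunction {X : Type*} [PseudoMetricSpace X] [MeasurableSpace X] (μ : Measure X)
    (f : X → ℝ) (x : X) : ℝ≥0∞ :=
  ⨆ (r : ℝ) (_ : 0 < r), (μ (Metric.ball x r))⁻¹ * ∫⁻ y in Metric.ball x r, ‖f y‖ₑ ∂μ

/-- The centred maximal operator of `μ` satisfies the weak type `(1,1)` inequality
with constant `C`. -/
def WeakTypeOneOne {X : Type*} [PseudoMetricSpace X] [MeasurableSpace X] (μ : Measure X)
    (C : ℝ≥0) : Prop :=
  ∀ f : X → ℝ, Integrable f μ → ∀ t : ℝ≥0, 0 < t →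
    μ {x | (t : ℝ≥0∞) < maximalFunction μ f x} ≤ ((C / t : ℝ≥0) : ℝ≥0∞) * eLpNorm f 1 μ

end

/-! In high dimension the unit ball has a fixed share of its volume at distance about `1/n` from the
sphere, where the weight is about `n ^ α`. So a thin annulus inside the sphere has `μ`-measure at
least `n ^ α / 12` times the volume of the unit ball (`le_withDensity_annulus`). Test the maximal
operator on the indicator of a tiny ball `B(0, ε)`. For `x` in the annulus, `B(x, |x| + ε)` contains
it and has `μ`-measure at most a dimension-free multiple of that volume
(`withDensity_ball_norm_add_le`): away from the sphere the weight is bounded, and the part near the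
sphere lies in a cone whose share of volume decays exponentially in `n`. Comparing the two measures
forces `C ≥ c * n ^ α`.

Finiteness of the constant comes from Besicovitch covering, and a least one exists because the
admissible constants form a closed set. Doubling follows by comparing integrals along rays when the
ball is near the sphere, and from near constancy of the weight when it is far. -/

/-! ### Polar coordinates. -/

section Polar

variable {E : Type*} [NormedAddCommGroup E] [NormedSpace ℝ E] [Nontrivial E]
  [FiniteDimensional ℝ E] [MeasurableSpace E] [BorelSpace E]

/-- Integration in polar coordinates. -/
theorem lintegral_eq_lintegral_toSphere (ν : Measure E) [ν.IsAddHaarMeasure]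
    {f : E → ℝ≥0∞} (hf : Measurable f) :
    ∫⁻ y, f y ∂ν = ∫⁻ ω : Metric.sphere (0 : E) 1, (∫⁻ t in Set.Ioi (0 : ℝ),
      ENNReal.ofReal (t ^ (Module.finrank ℝ E - 1)) * f (t • (ω : E))) ∂ν.toSphere := by
  have h1 : ∫⁻ y, f y ∂ν = ∫⁻ y : ({(0 : E)}ᶜ : Set E), f y ∂(ν.comap (↑)) := by
    rw [lintegral_subtype_comap (measurableSet_singleton _).compl, restrict_compl_singleton]
  have hm : Measurable fun p : Metric.sphere (0 : E) 1 × Set.Ioi (0 : ℝ) =>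
      f ((p.2 : ℝ) • (p.1 : E)) := by
    refine hf.comp ?_
    exact (measurable_subtype_coe.comp measurable_snd).smul
      (measurable_subtype_coe.comp measurable_fst)
  have h2 : ∫⁻ y : ({(0 : E)}ᶜ : Set E), f y ∂(ν.comap (↑)) =
      ∫⁻ p : Metric.sphere (0 : E) 1 × Set.Ioi (0 : ℝ), f ((p.2 : ℝ) • (p.1 : E))
        ∂(ν.toSphere.prod (Measure.volumeIoiPow (Module.finrank ℝ E - 1))) := by
    rw [← ν.measurePreserving_homeomorphUnitSphereProd.lintegral_comp hm]
    refine lintegral_congr fun y => ?_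
    have hy : ‖(y : E)‖ ≠ 0 := norm_ne_zero_iff.2 y.2
    simp [smul_smul, mul_inv_cancel₀ hy]
  rw [h1, h2, lintegral_prod _ hm.aemeasurable]
  refine lintegral_congr fun ω => ?_
  have hω : Measurable fun t : ℝ => f (t • (ω : E)) := hf.comp (by fun_prop)
  rw [Measure.volumeIoiPow]
  refine (lintegral_withDensity_eq_lintegral_mul _ (by fun_prop)
    (hω.comp measurable_subtype_coe)).trans ?_
  exact lintegral_subtype_comap measurableSet_Ioi
    (fun t : ℝ => ENNReal.ofReal (t ^ (Module.finrank ℝ E - 1)) * f (t • (ω : E)))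

/-- Integrals can be compared ray by ray. -/
theorem lintegral_le_of_forall_ray (ν : Measure E) [ν.IsAddHaarMeasure]
    {f g : E → ℝ≥0∞} (hf : Measurable f) (hg : Measurable g)
    (h : ∀ ω : E, ‖ω‖ = 1 →
      ∫⁻ t in Set.Ioi (0 : ℝ), ENNReal.ofReal (t ^ (Module.finrank ℝ E - 1)) * f (t • ω) ≤
      ∫⁻ t in Set.Ioi (0 : ℝ), ENNReal.ofReal (t ^ (Module.finrank ℝ E - 1)) * g (t • ω)) :
    ∫⁻ y, f y ∂ν ≤ ∫⁻ y, g y ∂ν := by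
  rw [lintegral_eq_lintegral_toSphere ν hf, lintegral_eq_lintegral_toSphere ν hg]
  exact lintegral_mono fun ω => h ω (by simp)

end Polar

/-! ### Integrals of the weight on a line. -/

section OneDim

theorem setLIntegral_abs_rpow_neg_le {α r : ℝ} (hα₁ : α < 1) (hr : 0 < r) :
    ∫⁻ t in Set.Ioo (-r) r, ENNReal.ofReal (|t| ^ (-α)) ≤
      ENNReal.ofReal (2 / (1 - α) * r ^ (1 - α)) := by
  have half : ∫⁻ t in Set.Ioc 0 r, ENNReal.ofReal (|t| ^ (-α)) =
      ENNReal.ofReal (r ^ (1 - α) / (1 - α)) := by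
    have hint : IntegrableOn (fun t : ℝ => t ^ (-α)) (Set.Ioc 0 r) :=
      (intervalIntegral.intervalIntegrable_rpow' (by linarith)).1
    rw [setLIntegral_congr_fun (g := fun t => ENNReal.ofReal (t ^ (-α))) measurableSet_Ioc
      (fun t ht => by simp only [abs_of_pos ht.1]),
      ← ofReal_integral_eq_lintegral_ofReal hint, ← intervalIntegral.integral_of_le hr.le,
      integral_rpow (Or.inl (by linarith)), Real.zero_rpow (by linarith)]
    · congr 1; rw [sub_zero, neg_add_eq_sub]
    · filter_upwards [ae_restrict_mem measurableSet_Ioc] with t ht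
      exact Real.rpow_nonneg ht.1.le _
  have half' : ∫⁻ t in Set.Ico (-r) 0, ENNReal.ofReal (|t| ^ (-α)) =
      ENNReal.ofReal (r ^ (1 - α) / (1 - α)) := by
    have := (Measure.measurePreserving_neg (volume : Measure ℝ)).setLIntegral_comp_preimage
      (measurableSet_Ioc (a := 0) (b := r))
      (f := fun t => ENNReal.ofReal (|t| ^ (-α))) (by fun_prop)
    rw [← half, ← this]
    simp
  have hsub : Set.Ioo (-r) r ⊆ Set.Ico (-r) 0 ∪ {0} ∪ Set.Ioc 0 r := by
    intro t ht
    rcases lt_trichotomy t 0 with h | h | h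
    · exact Or.inl (Or.inl ⟨ht.1.le, h⟩)
    · exact Or.inl (Or.inr h)
    · exact Or.inr ⟨h, ht.2.le⟩
  refine (lintegral_mono_set hsub).trans ((lintegral_union_le _ _ _).trans ?_)
  refine (add_le_add_left (lintegral_union_le _ _ _) _).trans ?_
  have hα' : 0 < 1 - α := by linarith
  rw [half, half']
  simp only [Measure.restrict_singleton, Real.volume_singleton, zero_smul, lintegral_zero_measure,
    add_zero]
  rw [← ENNReal.ofReal_add (by positivity) (by positivity)]
  apply le_of_eq; congr 1; ring

theorem setLIntegral_abs_one_sub_rpow_neg_le {α r : ℝ} (hα₁ : α < 1) (hr : 0 < r) :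
    ∫⁻ t in Set.Ioo (1 - r) (1 + r), ENNReal.ofReal (|1 - t| ^ (-α)) ≤
      ENNReal.ofReal (2 / (1 - α) * r ^ (1 - α)) := by
  refine le_trans (le_of_eq ?_) (setLIntegral_abs_rpow_neg_le hα₁ hr)
  rw [← (Measure.measurePreserving_sub_left (volume : Measure ℝ) 1).setLIntegral_comp_preimage
      measurableSet_Ioo (f := fun t => ENNReal.ofReal (|t| ^ (-α))) (by fun_prop)]
  congr 2
  ext t; simp only [Set.mem_Ioo, Set.mem_preimage]
  constructor <;> rintro ⟨h, h'⟩ <;> constructor <;> linarith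

/-- Averages of `|1 - t| ^ (-α)` over short intervals, wherever they are. -/
theorem setLIntegral_Ioo_abs_one_sub_rpow_neg_le {α r : ℝ} (hα₀ : 0 < α) (hα₁ : α < 1)
    (hr : 0 < r) (a : ℝ) :
    ∫⁻ t in Set.Ioo (a - r) (a + r), ENNReal.ofReal (|1 - t| ^ (-α)) ≤
      ENNReal.ofReal ((2 / (1 - α) + 2) * r ^ (1 - α)) := by
  have hα' : 0 < 1 - α := by linarith
  -- At distance at least `r` from the singularity the weight is at most `r ^ (-α)`; over length `2
  -- * r` this gives the extra `2` in the constant.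
  have hpt : ∀ t : ℝ, ENNReal.ofReal (|1 - t| ^ (-α)) ≤
      (Set.Ioo (1 - r) (1 + r)).indicator (fun t => ENNReal.ofReal (|1 - t| ^ (-α))) t +
        ENNReal.ofReal (r ^ (-α)) := by
    intro t
    by_cases ht : t ∈ Set.Ioo (1 - r) (1 + r)
    · simp [ht]
    · rw [Set.indicator_of_notMem ht, zero_add]
      have : r ≤ |1 - t| := by
        by_contra h
        rw [not_le, abs_lt] at h
        exact ht ⟨by linarith [h.2], by linarith [h.1]⟩
      exact ENNReal.ofReal_le_ofReal (Real.rpow_le_rpow_of_nonpos hr this (by linarith))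
  refine (lintegral_mono hpt).trans ?_
  rw [lintegral_add_right _ measurable_const]
  have h1 : ∫⁻ t in Set.Ioo (a - r) (a + r),
      (Set.Ioo (1 - r) (1 + r)).indicator (fun t => ENNReal.ofReal (|1 - t| ^ (-α))) t ≤
      ENNReal.ofReal (2 / (1 - α) * r ^ (1 - α)) := by
    refine (setLIntegral_le_lintegral _ _).trans ?_
    rw [lintegral_indicator measurableSet_Ioo]
    exact setLIntegral_abs_one_sub_rpow_neg_le hα₁ hr
  refine (add_le_add_left h1 _).trans ?_
  rw [setLIntegral_const, Real.volume_Ioo, ← ENNReal.ofReal_mul (by positivity),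
    ← ENNReal.ofReal_add (by positivity) (by apply mul_nonneg <;> [positivity; linarith])]
  apply ENNReal.ofReal_le_ofReal
  have : r ^ (1 - α) = r ^ (-α) * r := by
    rw [← Real.rpow_add_one hr.ne', neg_add_eq_sub]
  rw [this]
  apply le_of_eq; ring

end OneDim

/-! ### Existence of a least weak type constant. -/

section WeakType

/-- Besicovitch covering works with closed balls. An open ball is an increasing union of concentric
closed ones, so the strict inequality survives a small decrease of the radius. -/
theorem exists_closedBall_of_lt_maximalFunction {X : Type*} [PseudoMetricSpace X]
    [MeasurableSpace X] [OpensMeasurableSpace X] (μ : Measure X) (f : X → ℝ) {t : ℝ≥0} {x : X}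
    (h : (t : ℝ≥0∞) < maximalFunction μ f x) :
    ∃ r : ℝ, 0 < r ∧ (t : ℝ≥0∞) * μ (Metric.closedBall x r) ≤
      ∫⁻ y in Metric.closedBall x r, ‖f y‖ₑ ∂μ := by
  simp only [maximalFunction, lt_iSup_iff] at h
  obtain ⟨r, hr, h⟩ := h
  rw [mul_comm, ← div_eq_mul_inv] at h
  have h := ENNReal.mul_lt_of_lt_div h
  obtain ⟨u, hu, hur, hlim⟩ := exists_seq_strictMono_tendsto' hr
  have hball : Metric.ball x r = ⋃ k, Metric.closedBall x (u k) := by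
    ext y
    simp only [Metric.mem_ball, Set.mem_iUnion, Metric.mem_closedBall]
    constructor
    · intro hy
      obtain ⟨k, hk⟩ := (hlim.eventually (lt_mem_nhds hy)).exists
      exact ⟨k, hk.le⟩
    · rintro ⟨k, hk⟩
      exact hk.trans_lt (hur k).2
  have hmono : Monotone fun k => Metric.closedBall x (u k) := fun i j hij =>
    Metric.closedBall_subset_closedBall (hu.monotone hij)
  have hI : ∫⁻ y in Metric.ball x r, ‖f y‖ₑ ∂μ =
      ⨆ k, ∫⁻ y in Metric.closedBall x (u k), ‖f y‖ₑ ∂μ := by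
    rw [hball, setLIntegral_iUnion_of_directed _ hmono.directed_le]
  rw [hI, lt_iSup_iff] at h
  obtain ⟨k, hk⟩ := h
  refine ⟨u k, (hur k).1, le_trans ?_ hk.le⟩
  gcongr
  exact Metric.closedBall_subset_ball (hur k).2

/-- The centred maximal operator of any measure is of weak type `(1,1)` on a space with the
Besicovitch covering property. -/
theorem exists_weakTypeOneOne {X : Type*} [MetricSpace X] [SecondCountableTopology X]
    [HasBesicovitchCovering X] [MeasurableSpace X] [OpensMeasurableSpace X] (μ : Measure X) :
    ∃ C : ℝ≥0, WeakTypeOneOne μ C := by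
  obtain ⟨N, τ, hτ, hN⟩ := HasBesicovitchCovering.no_satelliteConfig (α := X)
  refine ⟨N, fun f _ t ht => ?_⟩
  have ht0 : (t : ℝ≥0∞) ≠ 0 := by exact_mod_cast ht.ne'
  have htt : (t : ℝ≥0∞) ≠ ∞ := ENNReal.coe_ne_top
  -- The covering theorem needs bounded radii, so the superlevel set is exhausted by increasing sets
  -- with radii at most `k`.
  let A : ℕ → Set X := fun k => {x | ∃ r : ℝ, 0 < r ∧ r ≤ k ∧
    (t : ℝ≥0∞) * μ (Metric.closedBall x r) ≤ ∫⁻ y in Metric.closedBall x r, ‖f y‖ₑ ∂μ}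
  have hA : Monotone A := by
    rintro i j hij x ⟨r, h0, h1, h2⟩
    exact ⟨r, h0, h1.trans (by exact_mod_cast hij), h2⟩
  have hsub : {x | (t : ℝ≥0∞) < maximalFunction μ f x} ⊆ ⋃ k, A k := by
    intro x hx
    obtain ⟨r, hr, h⟩ := exists_closedBall_of_lt_maximalFunction μ f hx
    obtain ⟨k, hk⟩ := exists_nat_ge r
    exact Set.mem_iUnion.2 ⟨k, r, hr, hk, h⟩
  refine (measure_mono hsub).trans ?_
  rw [hA.measure_iUnion]
  refine iSup_le fun k => ?_
  choose r hr hrk hrI using fun x : A k => x.2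
  obtain ⟨s, hs, hcov⟩ := Besicovitch.exist_disjoint_covering_families hτ hN
    (⟨fun x : A k => (x : X), r, hr, k, hrk⟩ : Besicovitch.BallPackage (A k) X)
  simp only [Subtype.range_coe] at hcov hs
  have hcount : ∀ i, (s i).Countable := fun i =>
    (hs i).countable_of_nonempty_interior fun x _ =>
      ⟨x, Metric.ball_subset_interior_closedBall (Metric.mem_ball_self (hr x))⟩
  have hfam : ∀ i, (t : ℝ≥0∞) * μ (⋃ x ∈ s i, Metric.ball (x : X) (r x)) ≤ eLpNorm f 1 μ := by
    intro i
    calc (t : ℝ≥0∞) * μ (⋃ x ∈ s i, Metric.ball (x : X) (r x))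
        ≤ t * ∑' x : s i, μ (Metric.closedBall ((x : A k) : X) (r x)) := by
          gcongr
          refine (measure_biUnion_le μ (hcount i) _).trans ?_
          gcongr
          exact Metric.ball_subset_closedBall
      _ = ∑' x : s i, t * μ (Metric.closedBall ((x : A k) : X) (r x)) := ENNReal.tsum_mul_left.symm
      _ ≤ ∑' x : s i, ∫⁻ y in Metric.closedBall ((x : A k) : X) (r x), ‖f y‖ₑ ∂μ :=
          ENNReal.tsum_le_tsum fun x => hrI x
      _ = ∫⁻ y in ⋃ x ∈ s i, Metric.closedBall (x : X) (r x), ‖f y‖ₑ ∂μ :=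
          (lintegral_biUnion (hcount i) (fun _ _ => measurableSet_closedBall) (hs i) _).symm
      _ ≤ eLpNorm f 1 μ := by
          rw [eLpNorm_one_eq_lintegral_enorm]
          exact setLIntegral_le_lintegral _ _
  rw [ENNReal.coe_div ht.ne', ENNReal.coe_natCast, div_eq_mul_inv, mul_right_comm,
    ← div_eq_mul_inv, ENNReal.le_div_iff_mul_le (Or.inl ht0) (Or.inl htt)]
  calc μ (A k) * t ≤ (∑ i : Fin N, μ (⋃ x ∈ s i, Metric.ball (x : X) (r x))) * t := by
        gcongr
        exact (measure_mono hcov).trans (measure_iUnion_fintype_le _ _)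
    _ = ∑ i : Fin N, t * μ (⋃ x ∈ s i, Metric.ball (x : X) (r x)) := by
        rw [mul_comm, Finset.mul_sum]
    _ ≤ ∑ _i : Fin N, eLpNorm f 1 μ := Finset.sum_le_sum fun i _ => hfam i
    _ = N * eLpNorm f 1 μ := by simp

/-- If there is a weak type constant, then there is a least one. -/
theorem exists_isLeast_weakTypeOneOne {X : Type*} [PseudoMetricSpace X] [MeasurableSpace X]
    {μ : Measure X} (h : ∃ C, WeakTypeOneOne μ C) :
    ∃ C, IsLeast {C' : ℝ≥0 | WeakTypeOneOne μ C'} C := by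
  -- Each pair of `f` and `t` imposes a closed condition on the constant, since `‖f‖₁` is finite.
  have hclosed : IsClosed {C' : ℝ≥0 | WeakTypeOneOne μ C'} := by
    have : {C' : ℝ≥0 | WeakTypeOneOne μ C'} = ⋂ (f : X → ℝ) (_ : Integrable f μ) (t : ℝ≥0)
        (_ : 0 < t), {C' : ℝ≥0 | μ {x | (t : ℝ≥0∞) < maximalFunction μ f x} ≤
          ((C' / t : ℝ≥0) : ℝ≥0∞) * eLpNorm f 1 μ} := by
      ext C; simp [WeakTypeOneOne]
    rw [this]
    refine isClosed_iInter fun f => isClosed_iInter fun hf => isClosed_iInter fun t =>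
      isClosed_iInter fun ht => isClosed_le continuous_const ?_
    exact (ENNReal.continuous_mul_const (memLp_one_iff_integrable.2 hf).eLpNorm_ne_top).comp
      (ENNReal.continuous_coe.comp (continuous_id.div_const t))
  exact ⟨_, hclosed.isLeast_csInf h (OrderBot.bddBelow _)⟩

end WeakType

/-! ### The doubling property. -/

section Doubling

variable {E : Type*} [NormedAddCommGroup E] [NormedSpace ℝ E]

theorem dist_smul_smul_of_norm_eq_one {ω : E} (hω : ‖ω‖ = 1) (s t : ℝ) :
    dist (s • ω) (t • ω) = |s - t| := by
  rw [dist_eq_norm, ← sub_smul, norm_smul, hω, mul_one, Real.norm_eq_abs]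

variable [Nontrivial E] [FiniteDimensional ℝ E] [MeasurableSpace E] [BorelSpace E]

/-- A ray meets `B(x, R)` only within `2 * R` of any one of its points `t₀ • ω` there. The mass on
that stretch is dominated by an outward segment of length `R` still inside `B(x, 4R)`, where the
Jacobian `t ^ m` is larger. -/
theorem setLIntegral_ball_abs_one_sub_norm_rpow_neg_le (ν : Measure E) [ν.IsAddHaarMeasure]
    {α R : ℝ} (hα₀ : 0 < α) (hα₁ : α < 1) (hR : 0 < R) (x : E) :
    ∫⁻ y in Metric.ball x R, ENNReal.ofReal (|1 - ‖y‖| ^ (-α)) ∂ν ≤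
      ENNReal.ofReal ((2 / (1 - α) + 2) * (2 * R) ^ (1 - α) / R) * ν (Metric.ball x (4 * R)) := by
  set m := Module.finrank ℝ E - 1
  set K : ℝ := (2 / (1 - α) + 2) * (2 * R) ^ (1 - α)
  have hα' : 0 < 1 - α := by linarith
  have hK0 : 0 ≤ K := by positivity
  have hW : Measurable fun y : E => ENNReal.ofReal (|1 - ‖y‖| ^ (-α)) := by fun_prop
  rw [← lintegral_indicator measurableSet_ball,
    ← lintegral_indicator_const measurableSet_ball]
  refine lintegral_le_of_forall_ray ν (hW.indicator measurableSet_ball)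
    (measurable_const.indicator measurableSet_ball) fun ω hω => ?_
  by_cases hex : ∃ t₀ : ℝ, 0 < t₀ ∧ t₀ • ω ∈ Metric.ball x R
  swap
  · rw [setLIntegral_congr_fun (g := fun _ => 0) measurableSet_Ioi]
    · simp
    · intro t ht
      have : t • ω ∉ Metric.ball x R := fun h => hex ⟨t, ht, h⟩
      simp [Set.indicator_of_notMem this]
  obtain ⟨t₀, ht₀, hmem⟩ := hex
  calc ∫⁻ t in Set.Ioi (0 : ℝ), ENNReal.ofReal (t ^ m) * (Metric.ball x R).indicator
        (fun y : E => ENNReal.ofReal (|1 - ‖y‖| ^ (-α))) (t • ω)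
      ≤ ∫⁻ t in Set.Ioi (0 : ℝ), (Set.Ioo (t₀ - 2 * R) (t₀ + 2 * R)).indicator
        (fun t => ENNReal.ofReal ((t₀ + 2 * R) ^ m) * ENNReal.ofReal (|1 - t| ^ (-α))) t := by
        refine setLIntegral_mono' measurableSet_Ioi fun t (ht : 0 < t) => ?_
        by_cases h : t • ω ∈ Metric.ball x R
        · have hd : |t - t₀| < 2 * R := by
            rw [← dist_smul_smul_of_norm_eq_one hω]
            have := dist_triangle_right (t • ω) (t₀ • ω) x
            rw [Metric.mem_ball] at h hmem
            linarith
          rw [abs_lt] at hd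
          have hI : t ∈ Set.Ioo (t₀ - 2 * R) (t₀ + 2 * R) := ⟨by linarith, by linarith⟩
          rw [Set.indicator_of_mem h, Set.indicator_of_mem hI, norm_smul, hω, mul_one,
            Real.norm_of_nonneg ht.le]
          gcongr
          exact hI.2.le
        · simp [Set.indicator_of_notMem h]
    _ ≤ ∫⁻ t in Set.Ioo (t₀ - 2 * R) (t₀ + 2 * R),
        ENNReal.ofReal ((t₀ + 2 * R) ^ m) * ENNReal.ofReal (|1 - t| ^ (-α)) := by
        rw [← lintegral_indicator measurableSet_Ioo]
        exact setLIntegral_le_lintegral _ _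
    _ ≤ ENNReal.ofReal ((t₀ + 2 * R) ^ m) * ENNReal.ofReal K := by
        rw [lintegral_const_mul _ (by fun_prop)]
        gcongr
        exact setLIntegral_Ioo_abs_one_sub_rpow_neg_le hα₀ hα₁ (by positivity) t₀
    _ = ∫⁻ _t in Set.Ioo (t₀ + 2 * R) (t₀ + 3 * R),
        ENNReal.ofReal ((t₀ + 2 * R) ^ m) * ENNReal.ofReal (K / R) := by
        rw [setLIntegral_const, Real.volume_Ioo, mul_assoc,
          ← ENNReal.ofReal_mul (p := K / R) (by positivity),
          show t₀ + 3 * R - (t₀ + 2 * R) = R by ring, div_mul_cancel₀ _ hR.ne']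
    _ ≤ ∫⁻ t in Set.Ioo (t₀ + 2 * R) (t₀ + 3 * R), ENNReal.ofReal (t ^ m) *
        (Metric.ball x (4 * R)).indicator (fun _ => ENNReal.ofReal (K / R)) (t • ω) := by
        refine setLIntegral_mono' measurableSet_Ioo fun t ht => ?_
        have h : t • ω ∈ Metric.ball x (4 * R) := by
          have h1 := dist_triangle (t • ω) (t₀ • ω) x
          rw [dist_smul_smul_of_norm_eq_one hω, abs_of_pos (by linarith [ht.1])] at h1
          rw [Metric.mem_ball] at hmem ⊢
          linarith [ht.2]
        rw [Set.indicator_of_mem h]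
        gcongr
        exact ht.1.le
    _ ≤ _ := lintegral_mono_set fun t ht => Set.mem_Ioi.2 (by linarith [ht.1])

/-- The measure `|1 - ‖x‖| ^ (-α) dx` is doubling. -/
theorem isDoubling_withDensity_abs_one_sub_norm (ν : Measure E) [ν.IsAddHaarMeasure]
    {α : ℝ} (hα₀ : 0 < α) (hα₁ : α < 1) :
    IsDoubling (ν.withDensity fun y => ENNReal.ofReal (|1 - ‖y‖| ^ (-α))) := by
  set n := Module.finrank ℝ E
  have hα' : 0 < 1 - α := by linarith
  -- On the sphere `0 ^ (-α) = 0` would break the lower bound for the weight, so this null set is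
  -- discarded.
  have hne : ∀ᵐ y ∂ν, ‖y‖ ≠ 1 := by
    have : ν (Metric.sphere (0 : E) 1) = 0 := Measure.addHaar_sphere ν 0 1
    rw [ae_iff]
    convert this using 2
    ext y; simp
  have hdist : ∀ x y : E, |(|1 - ‖x‖| - |1 - ‖y‖|)| ≤ dist x y := by
    intro x y
    refine (abs_abs_sub_abs_le _ _).trans ?_
    rw [show 1 - ‖x‖ - (1 - ‖y‖) = ‖y‖ - ‖x‖ by ring, abs_sub_comm, dist_eq_norm]
    exact abs_norm_sub_norm_le x y
  have hlower : ∀ (x : E) (R s : ℝ), (∀ y ∈ Metric.ball x R, |1 - ‖y‖| ≤ s) →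
      ENNReal.ofReal (s ^ (-α)) * ν (Metric.ball x R) ≤
        ∫⁻ y in Metric.ball x R, ENNReal.ofReal (|1 - ‖y‖| ^ (-α)) ∂ν := by
    intro x R s h
    rw [← setLIntegral_const]
    refine lintegral_mono_ae ?_
    filter_upwards [ae_restrict_mem measurableSet_ball, ae_restrict_of_ae hne] with y hy hy1
    exact ENNReal.ofReal_le_ofReal (Real.rpow_le_rpow_of_nonpos
      (abs_pos.2 (sub_ne_zero.2 (Ne.symm hy1))) (h y hy) (by linarith))
  have hscale : ∀ (x : E) (a R : ℝ), 0 < a → 0 < R →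
      ν (Metric.ball x (a * R)) = ENNReal.ofReal (a ^ n) * ν (Metric.ball x R) := by
    intro x a R ha hR
    rw [Measure.addHaar_ball ν x (by positivity), Measure.addHaar_ball ν x hR.le, ← mul_assoc,
      ← ENNReal.ofReal_mul (by positivity), mul_pow]
  -- `K₁` serves balls far from the sphere, where `|1 - ‖y‖|` lies between `D / 2` and `2 * D`. `K₂`
  -- serves the others, where it is at most `5 * R` on `B(x, R)`; `8 ^ n` is the volume ratio of
  -- `B(x, 8R)` to `B(x, R)`.
  set K₁ : ℝ := 4 ^ α * 2 ^ n
  set K₂ : ℝ := (2 / (1 - α) + 2) * 4 ^ (1 - α) / 2 * 5 ^ α * 8 ^ n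
  have hK₁ : 0 ≤ K₁ := by positivity
  have hK₂ : 0 ≤ K₂ := by positivity
  refine ⟨Real.toNNReal (max K₁ K₂), fun x R hR => ?_⟩
  rw [withDensity_apply _ measurableSet_ball, withDensity_apply _ measurableSet_ball]
  change _ ≤ ENNReal.ofReal (max K₁ K₂) * _
  rcases le_or_gt (4 * R) |1 - ‖x‖| with hfar | hnear
  · set D := |1 - ‖x‖|
    have hD : 0 < D := by linarith
    calc ∫⁻ y in Metric.ball x (2 * R), ENNReal.ofReal (|1 - ‖y‖| ^ (-α)) ∂ν
        ≤ ∫⁻ _y in Metric.ball x (2 * R), ENNReal.ofReal ((D / 2) ^ (-α)) ∂ν := by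
          refine setLIntegral_mono' measurableSet_ball fun y hy => ?_
          have h1 := (abs_le.1 (hdist y x)).1
          rw [Metric.mem_ball] at hy
          exact ENNReal.ofReal_le_ofReal (Real.rpow_le_rpow_of_nonpos (by positivity)
            (by linarith) (by linarith))
      _ = ENNReal.ofReal K₁ * (ENNReal.ofReal ((2 * D) ^ (-α)) * ν (Metric.ball x R)) := by
          rw [setLIntegral_const, hscale x 2 R two_pos hR, ← mul_assoc, ← mul_assoc,
            ← ENNReal.ofReal_mul (by positivity), ← ENNReal.ofReal_mul (by positivity)]
          congr 2
          have : D / 2 = (2 * D) / 4 := by ring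
          rw [this, Real.div_rpow (by positivity) (by positivity), Real.rpow_neg (x := 4)
            (by positivity), div_inv_eq_mul]
          ring
      _ ≤ _ := by
          gcongr
          · exact le_max_left _ _
          · refine hlower x R _ fun y hy => ?_
            have h1 := (abs_le.1 (hdist y x)).2
            rw [Metric.mem_ball] at hy
            linarith
  · calc ∫⁻ y in Metric.ball x (2 * R), ENNReal.ofReal (|1 - ‖y‖| ^ (-α)) ∂ν
        ≤ ENNReal.ofReal ((2 / (1 - α) + 2) * (2 * (2 * R)) ^ (1 - α) / (2 * R)) *
            ν (Metric.ball x (4 * (2 * R))) :=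
          setLIntegral_ball_abs_one_sub_norm_rpow_neg_le ν hα₀ hα₁ (by positivity) x
      _ = ENNReal.ofReal K₂ * (ENNReal.ofReal ((5 * R) ^ (-α)) * ν (Metric.ball x R)) := by
          rw [show 4 * (2 * R) = 8 * R by ring, show 2 * (2 * R) = 4 * R by ring,
            hscale x 8 R (by norm_num) hR, ← mul_assoc, ← mul_assoc,
            ← ENNReal.ofReal_mul (by positivity), ← ENNReal.ofReal_mul (by positivity)]
          congr 2
          rw [Real.mul_rpow (by positivity) hR.le, Real.mul_rpow (by positivity) hR.le,
            Real.rpow_neg (x := 5) (by positivity), sub_eq_neg_add, Real.rpow_add_one hR.ne']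
          have : (5 : ℝ) ^ α ≠ 0 := by positivity
          simp only [K₂, sub_eq_neg_add]
          field_simp
      _ ≤ _ := by
          gcongr
          · exact le_max_right _ _
          · refine hlower x R _ fun y hy => ?_
            have h1 := (abs_le.1 (hdist y x)).2
            rw [Metric.mem_ball] at hy
            linarith

end Doubling

/-! ### Growth of the weak type constant. -/

section LowerBound

/-- A lower bound for weak type constants, from the indicator function of a set `B`. -/
theorem WeakTypeOneOne.measure_le {X : Type*} [PseudoMetricSpace X] [MeasurableSpace X]
    {μ : Measure X} {C : ℝ≥0} (h : WeakTypeOneOne μ C) {B S : Set X} (hB : MeasurableSet B)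
    (hB₀ : μ B ≠ 0) (hB₁ : μ B ≠ ∞) {V : ℝ≥0∞} (hV₀ : V ≠ 0) (hV₁ : V ≠ ∞)
    (hS : ∀ x ∈ S, ∃ r : ℝ, 0 < r ∧ B ⊆ Metric.ball x r ∧ μ (Metric.ball x r) ≤ V) :
    μ S ≤ C * (2 * V) := by
  have h2V₀ : 2 * V ≠ 0 := mul_ne_zero two_ne_zero hV₀
  have h2V₁ : 2 * V ≠ ∞ := ENNReal.mul_ne_top ENNReal.ofNat_ne_top hV₁
  have htop : μ B / (2 * V) ≠ ∞ := ENNReal.div_ne_top hB₁ h2V₀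
  have hpos : μ B / (2 * V) ≠ 0 := ENNReal.div_ne_zero.2 ⟨hB₀, h2V₁⟩
  -- Averages reach `μ B / V`; half of that level makes the inequality strict, at the cost of a
  -- factor `2`.
  set t : ℝ≥0 := (μ B / (2 * V)).toNNReal
  have ht : (t : ℝ≥0∞) = μ B / (2 * V) := ENNReal.coe_toNNReal htop
  have ht₀ : 0 < t := ENNReal.toNNReal_pos hpos htop
  have hf : Integrable (B.indicator fun _ => (1 : ℝ)) μ :=
    (integrable_indicator_iff hB).2 (integrableOn_const hB₁)
  have hnorm : ∀ y, ‖B.indicator (fun _ => (1 : ℝ)) y‖ₑ = B.indicator (fun _ => (1 : ℝ≥0∞)) y := by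
    intro y
    by_cases hy : y ∈ B <;> simp [hy]
  have hI : eLpNorm (B.indicator fun _ => (1 : ℝ)) 1 μ = μ B := by
    rw [eLpNorm_one_eq_lintegral_enorm]
    simp only [hnorm]
    rw [lintegral_indicator_const hB, one_mul]
  have hsub : S ⊆ {x | (t : ℝ≥0∞) < maximalFunction μ (B.indicator fun _ => (1 : ℝ)) x} := by
    intro x hx
    obtain ⟨r, hr, hBr, hrV⟩ := hS x hx
    have h1 : (μ (Metric.ball x r))⁻¹ *
        ∫⁻ y in Metric.ball x r, ‖B.indicator (fun _ => (1 : ℝ)) y‖ₑ ∂μ ≤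
        maximalFunction μ (B.indicator fun _ => (1 : ℝ)) x := by
      unfold maximalFunction
      exact le_iSup₂_of_le r hr le_rfl
    refine lt_of_lt_of_le ?_ h1
    simp only [hnorm]
    rw [lintegral_indicator_const hB, one_mul, Measure.restrict_apply hB,
      Set.inter_eq_left.2 hBr, ht]
    refine lt_of_lt_of_le ?_ (mul_le_mul_left (ENNReal.inv_le_inv.2 hrV) _)
    rw [mul_comm V⁻¹, ← div_eq_mul_inv, mul_comm 2, div_eq_mul_inv,
      ENNReal.mul_inv (Or.inl hV₀) (Or.inl hV₁), ← mul_assoc, ← div_eq_mul_inv, ← div_eq_mul_inv]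
    exact ENNReal.half_lt_self (ENNReal.div_ne_zero.2 ⟨hB₀, hV₁⟩) (ENNReal.div_ne_top hB₁ hV₀)
  refine (measure_mono hsub).trans ((h _ hf t ht₀).trans_eq ?_)
  rw [hI, ENNReal.coe_div ht₀.ne', ht, div_eq_mul_inv, div_eq_mul_inv,
    ENNReal.mul_inv (Or.inl hB₀) (Or.inl hB₁), inv_inv, mul_assoc, mul_comm (μ B)⁻¹, mul_assoc,
    ENNReal.inv_mul_cancel hB₀ hB₁, mul_one]

/-- The base is `1 - 17/500`, so Bernoulli for its conjugate `1 + 17/500` gives the bound `500/17 <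
30`. -/
theorem nat_mul_pow_le (n : ℕ) : (n : ℝ) * (21 / 20 * (23 / 25)) ^ n ≤ 30 := by
  have h1 := one_add_mul_le_pow (show (-2 : ℝ) ≤ 17 / 500 by norm_num) n
  have h2 : ((21 / 20 * (23 / 25) : ℝ)) ^ n * (1 + 17 / 500) ^ n ≤ 1 := by
    rw [← mul_pow]
    exact pow_le_one₀ (by norm_num) (by norm_num)
  have h3 : (0 : ℝ) < (21 / 20 * (23 / 25)) ^ n := by positivity
  have h4 := mul_le_mul_of_nonneg_left h1 h3.le
  nlinarith

variable {E : Type*} [NormedAddCommGroup E] [InnerProductSpace ℝ E]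

/-- A ray that meets a ball `B(x, |x| + ε)` near the unit sphere makes an angle with `x` that is
bounded away from a right angle. -/
theorem norm_smul_sub_smul_lt {x ω : E} {ε t u : ℝ} (hx : 1 / 2 ≤ ‖x‖) (hxε : ‖x‖ + ε ≤ 1)
    (hε₀ : 0 < ε) (hε : ε ≤ 1 / 100) (hω : ‖ω‖ = 1) (ht : |1 - t| < 1 / 20)
    (hmem : t • ω ∈ Metric.ball x (‖x‖ + ε)) (hu₀ : 0 ≤ u) (hu₁ : u ≤ 1) :
    ‖u • ω - (2 / (5 * ‖x‖)) • x‖ < 23 / 25 := by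
  set a := ‖x‖ with ha
  set p := inner ℝ ω x with hp
  rw [abs_lt] at ht
  have ha0 : 0 < a := by linarith
  rw [Metric.mem_ball, dist_eq_norm] at hmem
  have h1 : ‖t • ω - x‖ ^ 2 = t ^ 2 - 2 * t * p + a ^ 2 := by
    rw [norm_sub_sq_real, norm_smul, hω, mul_one, Real.norm_eq_abs, sq_abs, real_inner_smul_left]
    ring
  have h2 : ‖t • ω - x‖ ^ 2 < (a + ε) ^ 2 := pow_lt_pow_left₀ hmem (norm_nonneg _) two_ne_zero
  rw [h1] at h2
  have h3 : 2 / 5 * a ≤ p := by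
    have h4 : t * (2 / 5 * a) ≤ t * p := by
      have : t * a ≤ t * 1 := by
        apply mul_le_mul_of_nonneg_left <;> linarith
      nlinarith
    exact le_of_mul_le_mul_left h4 (by linarith)
  have h5 : ‖u • ω - (2 / (5 * a)) • x‖ ^ 2 =
      u ^ 2 - 2 * u * (2 / (5 * a) * p) + (2 / 5) ^ 2 := by
    rw [norm_sub_sq_real, norm_smul, norm_smul, hω, real_inner_smul_left, real_inner_smul_right,
      Real.norm_eq_abs, Real.norm_eq_abs, mul_one, sq_abs, abs_of_pos (by positivity), ← ha, ← hp]
    field_simp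
  have h6 : (4 / 25 : ℝ) ≤ 2 / (5 * a) * p := by
    calc (4 / 25 : ℝ) = 2 / (5 * a) * (2 / 5 * a) := by field_simp; norm_num
      _ ≤ _ := by gcongr
  -- The bound `u ^ 2 - 8/25 * u + 4/25` is convex in `u`; on `[0, 1]` its maximum is `21/25`, at `u
  -- = 1`, below `(23/25) ^ 2 = 529/625`.
  refine lt_of_pow_lt_pow_left₀ 2 (by norm_num) ?_
  rw [h5]
  nlinarith

variable [Nontrivial E] [FiniteDimensional ℝ E] [MeasurableSpace E] [BorelSpace E]

/-- The part near the unit sphere of a ball `B(x, |x| + ε)` has small measure, since it lies in a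
cone of small aperture. -/
theorem setLIntegral_near_sphere_le (ν : Measure E) [ν.IsAddHaarMeasure] {α : ℝ} (hα₁ : α < 1)
    {x : E} {ε : ℝ} (hx : 1 / 2 ≤ ‖x‖) (hxε : ‖x‖ + ε ≤ 1) (hε₀ : 0 < ε) (hε : ε ≤ 1 / 100) :
    ∫⁻ y in Metric.ball x (‖x‖ + ε) ∩ {y | |1 - ‖y‖| < 1 / 20},
        ENNReal.ofReal (|1 - ‖y‖| ^ (-α)) ∂ν ≤
      ENNReal.ofReal (30 * (2 / (1 - α) * (1 / 20) ^ (1 - α))) * ν (Metric.ball 0 1) := by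
  set n := Module.finrank ℝ E with hn
  have hn0 : 0 < n := Module.finrank_pos
  set K : ℝ := 2 / (1 - α) * (1 / 20) ^ (1 - α)
  have hα' : 0 < 1 - α := by linarith
  have hK0 : 0 ≤ K := by positivity
  set A : Set E := Metric.ball x (‖x‖ + ε) ∩ {y | |1 - ‖y‖| < 1 / 20} with hA
  have hAm : MeasurableSet A :=
    measurableSet_ball.inter (measurableSet_lt (by fun_prop) measurable_const)
  have hW : Measurable fun y : E => ENNReal.ofReal (|1 - ‖y‖| ^ (-α)) := by fun_prop
  -- The unit segment of every relevant ray lies in the ball of radius `23/25 < 1` about `z`, which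
  -- has norm `2/5`.
  set z : E := (2 / (5 * ‖x‖)) • x
  have hpow : ∫⁻ t in Set.Ioo (0 : ℝ) 1, ENNReal.ofReal (t ^ (n - 1)) =
      ENNReal.ofReal (1 / n) := by
    rw [restrict_Ioo_eq_restrict_Ioc,
      ← ofReal_integral_eq_lintegral_ofReal (intervalIntegral.intervalIntegrable_pow _).1,
      ← intervalIntegral.integral_of_le zero_le_one, integral_pow]
    · congr 1
      rw [Nat.sub_add_cancel hn0, Nat.cast_sub hn0]
      simp [hn0.ne']
    · filter_upwards [ae_restrict_mem measurableSet_Ioc] with t ht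
      exact pow_nonneg ht.1.le _
  have main : ∫⁻ y in A, ENNReal.ofReal (|1 - ‖y‖| ^ (-α)) ∂ν ≤
      ENNReal.ofReal (n * (21 / 20) ^ (n - 1) * K) * ν (Metric.ball z (23 / 25)) := by
    rw [← lintegral_indicator hAm, ← lintegral_indicator_const measurableSet_ball]
    refine lintegral_le_of_forall_ray ν (hW.indicator hAm)
      (measurable_const.indicator measurableSet_ball) fun ω hω => ?_
    rw [← hn]
    by_cases hex : ∃ t₀ : ℝ, 0 < t₀ ∧ t₀ • ω ∈ A
    swap
    · rw [setLIntegral_congr_fun (g := fun _ => 0) measurableSet_Ioi]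
      · simp
      · intro t ht
        have : t • ω ∉ A := fun h => hex ⟨t, ht, h⟩
        simp [Set.indicator_of_notMem this]
    obtain ⟨t₀, ht₀, hball, hnear⟩ := hex
    have hnorm : ∀ t : ℝ, 0 < t → ‖t • ω‖ = t := fun t ht => by
      rw [norm_smul, hω, mul_one, Real.norm_of_nonneg ht.le]
    rw [Set.mem_ofPred_eq, hnorm t₀ ht₀] at hnear
    calc ∫⁻ t in Set.Ioi (0 : ℝ), ENNReal.ofReal (t ^ (n - 1)) * A.indicator
          (fun y : E => ENNReal.ofReal (|1 - ‖y‖| ^ (-α))) (t • ω)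
        ≤ ∫⁻ t in Set.Ioi (0 : ℝ), (Set.Ioo (1 - 1 / 20 : ℝ) (1 + 1 / 20)).indicator
          (fun t => ENNReal.ofReal ((21 / 20) ^ (n - 1)) * ENNReal.ofReal (|1 - t| ^ (-α))) t := by
          refine setLIntegral_mono' measurableSet_Ioi fun t (ht : 0 < t) => ?_
          by_cases h : t • ω ∈ A
          · have hd : |1 - ‖t • ω‖| < 1 / 20 := h.2
            rw [hnorm t ht, abs_lt] at hd
            have hI : t ∈ Set.Ioo (1 - 1 / 20 : ℝ) (1 + 1 / 20) := ⟨by linarith, by linarith⟩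
            rw [Set.indicator_of_mem h, Set.indicator_of_mem hI, hnorm t ht]
            gcongr
            linarith
          · simp [Set.indicator_of_notMem h]
      _ ≤ ∫⁻ t in Set.Ioo (1 - 1 / 20 : ℝ) (1 + 1 / 20),
          ENNReal.ofReal ((21 / 20) ^ (n - 1)) * ENNReal.ofReal (|1 - t| ^ (-α)) := by
          rw [← lintegral_indicator measurableSet_Ioo]
          exact setLIntegral_le_lintegral _ _
      _ ≤ ENNReal.ofReal ((21 / 20) ^ (n - 1)) * ENNReal.ofReal K := by
          rw [lintegral_const_mul _ (by fun_prop)]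
          gcongr
          exact setLIntegral_abs_one_sub_rpow_neg_le hα₁ (by norm_num)
      -- Spreading the mass over the unit segment costs a factor `n`, later absorbed by the
      -- exponential decay.
      _ = ∫⁻ t in Set.Ioo (0 : ℝ) 1, ENNReal.ofReal (t ^ (n - 1)) *
          ENNReal.ofReal (n * (21 / 20) ^ (n - 1) * K) := by
          rw [lintegral_mul_const _ (by fun_prop), hpow, ← ENNReal.ofReal_mul (by positivity),
            ← ENNReal.ofReal_mul (by positivity)]
          congr 1
          field_simp
      _ ≤ ∫⁻ t in Set.Ioo (0 : ℝ) 1, ENNReal.ofReal (t ^ (n - 1)) *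
          (Metric.ball z (23 / 25)).indicator
            (fun _ => ENNReal.ofReal (n * (21 / 20) ^ (n - 1) * K)) (t • ω) := by
          refine setLIntegral_mono' measurableSet_Ioo fun t ht => ?_
          have h : t • ω ∈ Metric.ball z (23 / 25) := by
            rw [Metric.mem_ball, dist_eq_norm]
            exact norm_smul_sub_smul_lt hx hxε hε₀ hε hω hnear hball ht.1.le ht.2.le
          rw [Set.indicator_of_mem h]
      _ ≤ _ := lintegral_mono_set fun t ht => ht.1
  refine main.trans ?_
  rw [Measure.addHaar_ball ν z (by norm_num), ← mul_assoc, ← ENNReal.ofReal_mul (by positivity)]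
  refine mul_le_mul_left (ENNReal.ofReal_le_ofReal ?_) _
  calc (n : ℝ) * (21 / 20) ^ (n - 1) * K * (23 / 25) ^ n
      ≤ n * (21 / 20) ^ n * K * (23 / 25) ^ n := by
        gcongr
        · norm_num
        · exact Nat.sub_le _ _
    _ = (n * (21 / 20 * (23 / 25)) ^ n) * K := by rw [mul_pow]; ring
    _ ≤ 30 * K := by gcongr; exact nat_mul_pow_le n

/-- The cone estimate handles `|1 - ‖y‖| < 1/20`; elsewhere the weight is at most `20 ^ α` and the
ball has radius at most `1`. The constant is free of the dimension. -/
theorem withDensity_ball_norm_add_le (ν : Measure E) [ν.IsAddHaarMeasure] {α : ℝ} (hα₀ : 0 < α)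
    (hα₁ : α < 1) {x : E} {ε : ℝ} (hx : 1 / 2 ≤ ‖x‖) (hxε : ‖x‖ + ε ≤ 1) (hε₀ : 0 < ε)
    (hε : ε ≤ 1 / 100) :
    ν.withDensity (fun y => ENNReal.ofReal (|1 - ‖y‖| ^ (-α))) (Metric.ball x (‖x‖ + ε)) ≤
      ENNReal.ofReal (30 * (2 / (1 - α) * (1 / 20) ^ (1 - α)) + 20 ^ α) *
        ν (Metric.ball 0 1) := by
  have hα' : 0 < 1 - α := by linarith
  have hm : MeasurableSet {y : E | |1 - ‖y‖| < 1 / 20} :=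
    measurableSet_lt (by fun_prop) measurable_const
  rw [withDensity_apply _ measurableSet_ball, ← lintegral_inter_add_sdiff _ _ hm,
    ENNReal.ofReal_add (by positivity) (by positivity), add_mul]
  refine add_le_add (setLIntegral_near_sphere_le ν hα₁ hx hxε hε₀ hε) ?_
  calc ∫⁻ y in Metric.ball x (‖x‖ + ε) \ {y | |1 - ‖y‖| < 1 / 20},
        ENNReal.ofReal (|1 - ‖y‖| ^ (-α)) ∂ν
      ≤ ∫⁻ _y in Metric.ball x (‖x‖ + ε) \ {y | |1 - ‖y‖| < 1 / 20},
        ENNReal.ofReal (20 ^ α) ∂ν := by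
        refine setLIntegral_mono' (measurableSet_ball.diff hm) fun y hy => ?_
        have h1 : 1 / 20 ≤ |1 - ‖y‖| := not_lt.1 hy.2
        have h2 : ((1 / 20 : ℝ)) ^ (-α) = 20 ^ α := by
          rw [one_div, Real.inv_rpow (by norm_num), Real.rpow_neg (by norm_num), inv_inv]
        rw [← h2]
        exact ENNReal.ofReal_le_ofReal (Real.rpow_le_rpow_of_nonpos (by norm_num) h1 (by linarith))
    _ ≤ ENNReal.ofReal (20 ^ α) * ν (Metric.ball x (‖x‖ + ε)) := by
        rw [setLIntegral_const]
        gcongr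
        exact Set.sdiff_subset
    _ ≤ ENNReal.ofReal (20 ^ α) * ν (Metric.ball 0 1) := by
        rw [← Measure.addHaar_ball_center ν x 1]
        gcongr

/-- The measure of a thin annulus inside the unit ball. -/
theorem le_withDensity_annulus (ν : Measure E) [ν.IsAddHaarMeasure] {α : ℝ} (hα₀ : 0 < α) {n : ℕ}
    (hn : Module.finrank ℝ E = n) :
    ENNReal.ofReal ((n : ℝ) ^ α / 12) * ν (Metric.ball 0 1) ≤
      ν.withDensity (fun y => ENNReal.ofReal (|1 - ‖y‖| ^ (-α)))
        (Metric.ball 0 (1 - 1 / (4 * n)) \ Metric.ball 0 (1 - 1 / (2 * n))) := by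
  have hn0 : 1 ≤ n := hn ▸ Module.finrank_pos
  have hn1 : (1 : ℝ) ≤ n := by exact_mod_cast hn0
  have hm : MeasurableSet
      (Metric.ball (0 : E) (1 - 1 / (4 * n)) \ Metric.ball 0 (1 - 1 / (2 * n))) :=
    measurableSet_ball.diff measurableSet_ball
  have h2n : 1 / (2 * (n : ℝ)) ≤ 1 / 2 := by
    rw [div_le_div_iff₀ (by positivity) (by norm_num)]; linarith
  have h4n : 1 / (4 * (n : ℝ)) ≤ 1 / (2 * n) := by
    apply one_div_le_one_div_of_le <;> linarith
  have h4n0 : 0 < 1 / (4 * (n : ℝ)) := by positivity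
  have hvol : ENNReal.ofReal (1 / 12) * ν (Metric.ball 0 1) ≤
      ν (Metric.ball (0 : E) (1 - 1 / (4 * n)) \ Metric.ball 0 (1 - 1 / (2 * n))) := by
    rw [measure_sdiff (Metric.ball_subset_ball (by linarith)) measurableSet_ball.nullMeasurableSet
      measure_ball_lt_top.ne,
      Measure.addHaar_ball ν 0 (r := 1 - 1 / (4 * n)) (by linarith),
      Measure.addHaar_ball ν 0 (r := 1 - 1 / (2 * n)) (by linarith), hn,
      ← ENNReal.sub_mul (fun _ _ => measure_ball_lt_top.ne),
      ← ENNReal.ofReal_sub _ (pow_nonneg (by linarith) _)]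
    gcongr
    -- Bernoulli bounds the outer power below by `3/4` and the inner one above by `2/3`; the
    -- difference is `1/12`.
    have h1 := one_add_mul_le_pow (show (-2 : ℝ) ≤ -(1 / (4 * n)) by linarith) n
    have h2 := one_add_mul_le_pow (show (-2 : ℝ) ≤ 1 / (2 * n) by linarith) n
    have h3 : (1 - 1 / (2 * (n : ℝ))) ^ n * (1 + 1 / (2 * n)) ^ n ≤ 1 := by
      rw [← mul_pow]
      apply pow_le_one₀ <;> nlinarith
    have h4 : 0 ≤ (1 - 1 / (2 * (n : ℝ))) ^ n := pow_nonneg (by linarith) _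
    have h5 : (n : ℝ) * -(1 / (4 * n)) = -(1 / 4) := by field_simp
    have h6 : (n : ℝ) * (1 / (2 * n)) = 1 / 2 := by field_simp
    rw [h5, ← sub_eq_add_neg, ← sub_eq_add_neg] at h1
    rw [h6] at h2
    nlinarith
  rw [withDensity_apply _ hm]
  calc ENNReal.ofReal ((n : ℝ) ^ α / 12) * ν (Metric.ball 0 1)
      = ENNReal.ofReal ((n : ℝ) ^ α) * (ENNReal.ofReal (1 / 12) * ν (Metric.ball 0 1)) := by
        rw [← mul_assoc, ← ENNReal.ofReal_mul (by positivity), mul_one_div]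
    _ ≤ _ := by
        refine (mul_le_mul_right hvol _).trans ?_
        rw [← setLIntegral_const]
        refine setLIntegral_mono' hm fun y hy => ENNReal.ofReal_le_ofReal ?_
        have hy1 : ‖y‖ < 1 - 1 / (4 * n) := by simpa using hy.1
        have hy2 : 1 - 1 / (2 * n) ≤ ‖y‖ := by simpa using hy.2
        have h7 : |1 - ‖y‖| = 1 - ‖y‖ := abs_of_pos (by linarith)
        calc (n : ℝ) ^ α = (1 / n : ℝ) ^ (-α) := by
              rw [one_div, Real.inv_rpow (by positivity), Real.rpow_neg (by positivity), inv_inv]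
          _ ≤ |1 - ‖y‖| ^ (-α) := by
              refine Real.rpow_le_rpow_of_nonpos (by rw [h7]; linarith) ?_ (by linarith)
              have : 1 / (2 * (n : ℝ)) ≤ 1 / n := by
                apply one_div_le_one_div_of_le <;> linarith
              rw [h7]; linarith

/-- The weak type constants grow at least like `n ^ α`. -/
theorem WeakTypeOneOne.rpow_le (ν : Measure E) [ν.IsAddHaarMeasure] {α : ℝ} (hα₀ : 0 < α)
    (hα₁ : α < 1) {n : ℕ} (hn : Module.finrank ℝ E = n) {C : ℝ≥0}
    (h : WeakTypeOneOne (ν.withDensity fun y => ENNReal.ofReal (|1 - ‖y‖| ^ (-α))) C) :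
    (n : ℝ) ^ α / 12 ≤ C * (2 * (30 * (2 / (1 - α) * (1 / 20) ^ (1 - α)) + 20 ^ α)) := by
  have hα' : 0 < 1 - α := by linarith
  have hn0 : 1 ≤ n := hn ▸ Module.finrank_pos
  have hn1 : (1 : ℝ) ≤ n := by exact_mod_cast hn0
  set D : ℝ := 30 * (2 / (1 - α) * (1 / 20) ^ (1 - α)) + 20 ^ α
  have hD : 0 < D := by positivity
  have hv₀ : ν (Metric.ball 0 1) ≠ 0 := (Metric.measure_ball_pos ν 0 one_pos).ne'
  have hv₁ : ν (Metric.ball 0 1) ≠ ∞ := measure_ball_lt_top.ne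
  -- Small enough for the cone estimate, and for `‖x‖ + ε ≤ 1` throughout the annulus.
  set ε : ℝ := 1 / (100 * n)
  have hε₀ : 0 < ε := by positivity
  have hε : ε ≤ 1 / 100 := by
    apply one_div_le_one_div_of_le <;> linarith
  have hε4 : ε ≤ 1 / (4 * n) := by
    apply one_div_le_one_div_of_le <;> linarith
  have h2n : 1 / (2 * (n : ℝ)) ≤ 1 / 2 := by
    apply one_div_le_one_div_of_le <;> linarith
  have hS := h.measure_le (B := Metric.ball 0 ε)
    (S := Metric.ball 0 (1 - 1 / (4 * n)) \ Metric.ball 0 (1 - 1 / (2 * n)))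
    (V := ENNReal.ofReal D * ν (Metric.ball 0 1)) measurableSet_ball ?_ ?_ ?_ ?_ ?_
  · have := (le_withDensity_annulus ν hα₀ hn).trans hS
    rw [← mul_assoc, ← mul_assoc, ENNReal.mul_le_mul_iff_left hv₀ hv₁,
      ← ENNReal.ofReal_coe_nnreal, show (2 : ℝ≥0∞) = ENNReal.ofReal 2 by simp,
      ← ENNReal.ofReal_mul (by positivity), ← ENNReal.ofReal_mul (by positivity),
      ENNReal.ofReal_le_ofReal_iff (by positivity)] at this
    linarith
  · rw [withDensity_apply _ measurableSet_ball]
    refine (lt_of_lt_of_le (Metric.measure_ball_pos ν (0 : E) hε₀) ?_).ne'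
    rw [← setLIntegral_one]
    refine setLIntegral_mono' measurableSet_ball fun y hy => ?_
    have hy : ‖y‖ < ε := by simpa using hy
    rw [← ENNReal.ofReal_one]
    have := norm_nonneg y
    have h7 : |1 - ‖y‖| = 1 - ‖y‖ := abs_of_pos (by linarith)
    refine ENNReal.ofReal_le_ofReal ?_
    exact Real.one_le_rpow_of_pos_of_le_one_of_nonpos (by rw [h7]; linarith)
      (by rw [h7]; linarith) (by linarith)
  · rw [withDensity_apply _ measurableSet_ball]
    refine ne_top_of_le_ne_top (ENNReal.mul_ne_top ENNReal.ofReal_ne_top measure_ball_lt_top.ne)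
      (setLIntegral_ball_abs_one_sub_norm_rpow_neg_le ν hα₀ hα₁ hε₀ 0)
  · exact mul_ne_zero (by simpa using hD) hv₀
  · exact ENNReal.mul_ne_top ENNReal.ofReal_ne_top hv₁
  · rintro x ⟨hx1, hx2⟩
    have hx1 : ‖x‖ < 1 - 1 / (4 * n) := by simpa using hx1
    have hx2 : 1 - 1 / (2 * n) ≤ ‖x‖ := by simpa using hx2
    refine ⟨‖x‖ + ε, by positivity, ?_,
      withDensity_ball_norm_add_le ν hα₀ hα₁ (by linarith) (by linarith) hε₀ hε⟩
    refine Metric.ball_subset_ball' ?_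
    rw [dist_zero_left, add_comm]

end LowerBound

/-! ### Assembly. -/

theorem theorem4p1 (α : ℝ) (hα₀ : 0 < α) (hα₁ : α < 1) :
    (∀ n : ℕ, 1 ≤ n → IsDoubling (radialMeasure α n)) ∧
    (∃ c : ℝ, 0 < c ∧ ∀ n : ℕ, 1 ≤ n →
      ∃ C : ℝ≥0, IsLeast {C' : ℝ≥0 | WeakTypeOneOne (radialMeasure α n) C'} C ∧
        c * (n : ℝ) ^ α ≤ (C : ℝ)) ∧
    ¬ ∃ C : ℝ≥0, ∀ n : ℕ, 1 ≤ n → WeakTypeOneOne (radialMeasure α n) C := by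
  have hα' : 0 < 1 - α := by linarith
  set D : ℝ := 30 * (2 / (1 - α) * (1 / 20) ^ (1 - α)) + 20 ^ α with hDdef
  have hD : 0 < D := by positivity
  -- Holding for every admissible constant, this bounds the least one and also rules out a uniform
  -- one; `24` is `12 * 2`.
  have hlow : ∀ n : ℕ, 1 ≤ n → ∀ C : ℝ≥0, WeakTypeOneOne (radialMeasure α n) C →
      1 / (24 * D) * (n : ℝ) ^ α ≤ C := by
    intro n hn C hC
    have : Nonempty (Fin n) := ⟨⟨0, hn⟩⟩
    have h := WeakTypeOneOne.rpow_le volume hα₀ hα₁ (finrank_euclideanSpace_fin (𝕜 := ℝ)) hC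
    rw [← hDdef] at h
    rw [one_div_mul_eq_div, div_le_iff₀ (by positivity)]
    linarith
  refine ⟨fun n hn => ?_, ⟨1 / (24 * D), by positivity, fun n hn => ?_⟩, ?_⟩
  · have : Nonempty (Fin n) := ⟨⟨0, hn⟩⟩
    exact isDoubling_withDensity_abs_one_sub_norm volume hα₀ hα₁
  · obtain ⟨C, hC⟩ := exists_isLeast_weakTypeOneOne (exists_weakTypeOneOne (radialMeasure α n))
    exact ⟨C, hC, hlow n hn C hC.1⟩
  · rintro ⟨C, hC⟩
    have htend : Filter.Tendsto (fun n : ℕ => 1 / (24 * D) * (n : ℝ) ^ α) Filter.atTop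
        Filter.atTop :=
      ((tendsto_rpow_atTop hα₀).comp tendsto_natCast_atTop_atTop).const_mul_atTop (by positivity)
    obtain ⟨n, hn, hCn⟩ :=
      ((Filter.eventually_ge_atTop 1).and (htend.eventually_gt_atTop (C : ℝ))).exists
    exact absurd (hlow n hn C (hC n hn)) (not_le.2 hCn)
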